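/- All rings are commutative, associative and unital, and modules are unital. An $R$-module $N$ is called reduced if, for all $r\in R$ and $m\in N$, $r^2m=0$ implies $rm=0$. For an $R$-module $N$, let $\operatorname{Red}(N)$ be the sum of all submodules of $N$ that are reduced as modules, and call $N$ semi-reduced if $\operatorname{Red}(N)=N$. An $R$-module $M$ is called strongly Red-injective if, for every $R$-module $N$ and every semi-reduced submodule $K$ of $N$, every $R$-homomorphism $K\to M$ extends to an $R$-homomorphism $N\to M$. A ring $R$ is called quasi-Frobenius if it is Artinian and injective as a module over itself. Theorem. A ring $R$ is quasi-Frobenius if and only if every strongly Red-injective $R$-module is projective. -/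

import Mathlib

universe u v w

/-- A module `M` over a commutative ring is reduced if `r² m = 0` implies `r m = 0`. -/
def IsReducedModule (R : Type u) (M : Type v) [CommRing R] [AddCommGroup M] [Module R M] : Prop :=
  ∀ (r : R) (m : M), r ^ 2 • m = 0 → r • m = 0

/-- `Red(M)`: the sum of all submodules of `M` that are reduced as modules. -/
def Red (R : Type u) (M : Type v) [CommRing R] [AddCommGroup M] [Module R M] : Submodule R M :=
  sSup {N : Submodule R M | IsReducedModule R N}

/-- A module `M` is semi-reduced if `Red(M) = M`. -/
def IsSemiReducedModule (R : Type u) (M : Type v) [CommRing R] [AddCommGroup M] [Module R M] :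
    Prop :=
  Red R M = ⊤

/-- `M` is `Red`-`N`-injective if every homomorphism from a semi-reduced submodule `K` of `N`
to `M` extends to `N`. -/
def IsRedInjectiveRel (R : Type u) (M : Type v) (N : Type w) [CommRing R]
    [AddCommGroup M] [Module R M] [AddCommGroup N] [Module R N] : Prop :=
  ∀ K : Submodule R N, IsSemiReducedModule R K →
    ∀ f : K →ₗ[R] M, ∃ g : N →ₗ[R] M, ∀ x : K, g (x : N) = f x

/-- `M` is strongly `Red`-injective if it is `Red`-`N`-injective for all modules `N`. -/
def IsStronglyRedInjective (R : Type u) (M : Type v) [CommRing R]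
    [AddCommGroup M] [Module R M] : Prop :=
  ∀ (N : Type v) [AddCommGroup N] [Module R N], IsRedInjectiveRel R M N

/-- A commutative ring is quasi-Frobenius if it is Artinian and self-injective. -/
def IsQuasiFrobenius (R : Type u) [CommRing R] : Prop :=
  IsArtinianRing R ∧ Module.Injective R R

/-! Over an Artinian ring the semi-reduced test submodules already suffice: a module killed by the
nilradical is reduced, and induction on nilradical powers extends every map, so strongly
`Red`-injective means injective. Injective modules are always strongly `Red`-injective, so what
remains is the Faith–Walker theorem: `R` is quasi-Frobenius iff injectives are projective.

If injectives are projective, they embed in free modules. A large power of the character module then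
forces the Noetherian condition, double annihilators give the Artinian one, and a trace ideal equal
to `R` gives self-injectivity. Conversely, over a quasi-Frobenius ring an injective module embeds in
a free module through its socle, and the embedding splits. -/

/-! ### Maps from products to free modules: the Noetherian condition -/

theorem exists_finset_forall_notMem_smul_eq_zero {R X V : Type*} [CommRing R] [AddCommGroup V]
    [Module R V] (φ : (ℕ → V) →ₗ[R] (X →₀ R)) (I : ℕ →o Ideal R) :
    ∃ (n : ℕ) (F : Finset X), ∀ x : ℕ → V, (∀ i < n, x i = 0) → (∀ r ∈ I n, r • x = 0) →
      ∀ j ∉ F, ∀ k, ∀ r ∈ I k, r * φ x j = 0 := by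
  classical
  by_contra! h
  choose x hx0 hxI j hjF k r hr hne using h
  -- Gliding hump: each counterexample `z m` starts beyond index `N m` and has a bad coordinate
  -- outside all earlier supports. The sum `t` makes sense coordinatewise, and `φ t` is nonzero at
  -- infinitely many coordinates.
  let s : ℕ → ℕ × Finset X := fun m => Nat.rec (0, ∅)
    (fun _ p => (max (k p.1 p.2) (p.1 + 1), p.2 ∪ (φ (x p.1 p.2)).support)) m
  let N : ℕ → ℕ := fun m => (s m).1
  let F : ℕ → Finset X := fun m => (s m).2
  let z : ℕ → ℕ → V := fun m => x (N m) (F m)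
  have hN : ∀ m, N (m + 1) = max (k (N m) (F m)) (N m + 1) := fun m => rfl
  have hF : ∀ m, F (m + 1) = F m ∪ (φ (z m)).support := fun m => rfl
  have hNmono : Monotone N := monotone_nat_of_le_succ fun m => by rw [hN]; omega
  have hFmono : Monotone F := monotone_nat_of_le_succ fun m => by
    rw [hF]; exact Finset.subset_union_left
  have hNge : ∀ m, m ≤ N m := by
    intro m
    induction m with
    | zero => exact Nat.zero_le _
    | succ m ih => rw [hN]; omega
  have hz0 : ∀ l i, i < l → z l i = 0 := fun l i hi => hx0 _ _ i (hi.trans_le (hNge l))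
  let t : ℕ → V := fun i => ∑ l ∈ Finset.range (i + 1), z l i
  have ht : ∀ m i, i < m → t i = ∑ l ∈ Finset.range m, z l i := by
    intro m i hi
    refine Finset.sum_subset (Finset.range_mono hi) fun l _ hl => hz0 l i ?_
    simpa [Nat.lt_succ_iff] using hl
  have htail : ∀ m, ∀ a ∈ I (N m), a • (t - ∑ l ∈ Finset.range m, z l) = 0 := by
    intro m a ha
    funext i
    have h1 : m ≤ max m (i + 1) := le_max_left _ _
    rw [Pi.smul_apply, Pi.sub_apply, Finset.sum_apply, ht (max m (i + 1)) i (by omega),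
      ← Finset.sum_Ico_eq_sub _ h1, Finset.smul_sum, Pi.zero_apply]
    refine Finset.sum_eq_zero fun l hl => ?_
    exact congrFun (hxI (N l) (F l) a (I.monotone (hNmono (Finset.mem_Ico.1 hl).1) ha)) i
  have hjs : ∀ m, j (N m) (F m) ∈ (φ (z m)).support := by
    intro m
    rw [Finsupp.mem_support_iff]
    intro h0
    exact hne (N m) (F m) (by simp only [z] at h0; rw [h0, mul_zero])
  have hjinj : Function.Injective fun m => j (N m) (F m) := by
    refine Function.Injective.of_lt_imp_ne fun l m hlm he => ?_
    refine hjF (N m) (F m) (hFmono (Nat.succ_le_of_lt hlm) ?_)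
    rw [← he, Nat.succ_eq_add_one, hF]
    exact Finset.mem_union_right _ (hjs l)
  have hsub : ∀ m l, l < m → (φ (z l)).support ⊆ F m := fun m l hl =>
    (Finset.subset_union_right.trans (hF l).ge).trans (hFmono (Nat.succ_le_of_lt hl))
  have hmem : ∀ m, j (N m) (F m) ∈ (φ t).support := by
    intro m
    rw [Finsupp.mem_support_iff]
    intro h0
    have h1 : t = (t - ∑ l ∈ Finset.range (m + 1), z l) + (∑ l ∈ Finset.range m, z l) + z m := by
      rw [Finset.sum_range_succ]; abel
    have h2 : (∑ l ∈ Finset.range m, φ (z l)) (j (N m) (F m)) = 0 := by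
      rw [Finsupp.finsetSum_apply]
      refine Finset.sum_eq_zero fun l hl => ?_
      exact Finsupp.notMem_support_iff.1
        fun hc => hjF _ _ (hsub m l (Finset.mem_range.1 hl) hc)
    have hrm := hr (N m) (F m)
    have h3 : r (N m) (F m) * (φ (t - ∑ l ∈ Finset.range (m + 1), z l)) (j (N m) (F m)) = 0 := by
      have h4 := htail (m + 1) _ (I.monotone ((le_max_left _ _).trans (hN m).ge) hrm)
      have h5 := congrArg φ h4
      rw [map_smul, map_zero] at h5
      exact DFunLike.congr_fun h5 _
    refine hne (N m) (F m) ?_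
    have h6 := DFunLike.congr_fun (congrArg φ h1) (j (N m) (F m))
    rw [map_add, map_add, map_sum, Finsupp.add_apply, Finsupp.add_apply, h2, h0] at h6
    have h7 := congrArg (r (N m) (F m) * ·) h6
    simp only [mul_add, h3, mul_zero, zero_add, add_zero] at h7
    exact h7.symm
  exact (Set.infinite_of_injective_forall_mem hjinj hmem) (Finset.finite_toSet _)

/-- A counting argument: if `e` is a counterexample, each `Z ⊆ (ℕ → R)` yields an element `x Z`,
determined by the coordinates of its image in the finite set `F`. These form a point of `ℕ → R`,
against Cantor. -/
theorem exists_forall_smul_eq_zero_of_injective {R X E : Type*} [CommRing R] [AddCommGroup E]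
    [Module R E] (φ : (ℕ → (ℕ → R) → E) →ₗ[R] (X →₀ R)) (hφ : Function.Injective φ)
    (I : ℕ →o Ideal R) :
    ∃ n, ∀ m, n ≤ m → ∀ e : E, (∀ r ∈ I n, r • e = 0) → ∀ r ∈ I m, r • e = 0 := by
  classical
  obtain ⟨n, F, h⟩ := exists_finset_forall_notMem_smul_eq_zero φ I
  refine ⟨n, fun m _ e he r hr => ?_⟩
  by_contra hre
  let x : Set (ℕ → R) → ℕ → (ℕ → R) → E := fun Z => Pi.single n fun y => if y ∈ Z then e else 0
  obtain ⟨ι, hι⟩ := Countable.exists_injective_nat F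
  refine Function.cantor_injective
    (fun Z : Set (ℕ → R) => Function.extend ι (fun j : F => φ (x Z) j) 0) fun Z W hZW => ?_
  have hF : ∀ j ∈ F, φ (x Z - x W) j = 0 := by
    intro j hj
    have := congrFun hZW (ι ⟨j, hj⟩)
    simp only [hι.extend_apply] at this
    rw [map_sub, Finsupp.sub_apply, this, sub_self]
  have hx0 : ∀ i < n, (x Z - x W) i = 0 := fun i hi => by
    simp [x, Pi.single_eq_of_ne hi.ne]
  have hxe : ∀ i y, (x Z - x W) i y = 0 ∨ (x Z - x W) i y = e ∨ (x Z - x W) i y = -e := by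
    intro i y
    by_cases hi : i = n
    · subst hi
      by_cases h1 : y ∈ Z <;> by_cases h2 : y ∈ W <;> simp [x, h1, h2]
    · simp [x, Pi.single_eq_of_ne hi]
  have hxI : ∀ a ∈ I n, a • (x Z - x W) = 0 := by
    intro a ha
    funext i y
    change a • (x Z - x W) i y = 0
    rcases hxe i y with h' | h' | h' <;> simp [h', he a ha]
  have hφ0 : φ (r • (x Z - x W)) = 0 := by
    ext j
    rw [map_smul, Finsupp.smul_apply, Finsupp.zero_apply, smul_eq_mul]
    by_cases hj : j ∈ F
    · rw [hF j hj, mul_zero]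
    · exact h _ hx0 hxI j hj m r hr
  have h0 := (map_eq_zero_iff φ hφ).1 hφ0
  ext y
  have h1 : r • (x Z - x W) n y = 0 := congrFun (congrFun h0 n) y
  by_cases h2 : y ∈ Z <;> by_cases h3 : y ∈ W <;> simp [x, h2, h3] at h1 ⊢ <;> exact hre h1

theorem Module.Projective.exists_injective_finsupp (R : Type*) (P : Type*) [CommRing R]
    [AddCommGroup P] [Module R P] [h : Module.Projective R P] :
    ∃ φ : P →ₗ[R] (P →₀ R), Function.Injective φ := by
  obtain ⟨s, hs⟩ := h.out
  exact ⟨s, hs.injective⟩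

/-- Characters of `R ⧸ I` separate points, so an ideal is recovered from its annihilator in the
character module. -/
theorem CharacterModule.forall_smul_eq_zero_iff {R : Type*} [CommRing R] (I : Ideal R) (r : R) :
    r ∈ I ↔ ∀ c : CharacterModule R, (∀ a ∈ I, a • c = 0) → r • c = 0 := by
  constructor
  · exact fun h c hc => hc r h
  · intro h
    rw [← Ideal.Quotient.eq_zero_iff_mem]
    refine CharacterModule.eq_zero_of_character_apply fun c => ?_
    have := h (CharacterModule.dual I.mkQ c) fun a ha => by
      ext b
      change c (Ideal.Quotient.mk I (a * b)) = 0
      rw [Ideal.Quotient.eq_zero_iff_mem.2 (I.mul_mem_right b ha), map_zero]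
    have h1 := DFunLike.congr_fun this 1
    change c (Ideal.Quotient.mk I (r * 1)) = 0 at h1
    rwa [mul_one] at h1

variable {R : Type u} [CommRing R]

theorem isNoetherianRing_of_injective_imp_projective
    (h : ∀ (M : Type u) [AddCommGroup M] [Module R M], Module.Injective R M →
      Module.Projective R M) : IsNoetherianRing R := by
  have hE : Module.Injective R (CharacterModule R) :=
    Module.Flat.iff_characterModule_injective.1 inferInstance
  have := h (ℕ → (ℕ → R) → CharacterModule R) inferInstance
  obtain ⟨φ, hφ⟩ := Module.Projective.exists_injective_finsupp R
    (ℕ → (ℕ → R) → CharacterModule R)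
  refine monotone_stabilizes_iff_noetherian.1 fun I => ?_
  obtain ⟨n, hn⟩ := exists_forall_smul_eq_zero_of_injective φ hφ I
  refine ⟨n, fun m hm => le_antisymm (I.monotone hm) fun r hr => ?_⟩
  exact (CharacterModule.forall_smul_eq_zero_iff _ _).2 fun c hc => hn m hm c hc r hr

/-! ### Double annihilators and the Artinian condition -/

theorem exists_injective_linearMap_injective_module (M : Type u) [AddCommGroup M] [Module R M] :
    ∃ (Q : Type u) (_ : AddCommGroup Q) (_ : Module R Q) (f : M →ₗ[R] Q),
      Module.Injective R Q ∧ Function.Injective f := by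
  let J := CategoryTheory.Injective.under (ModuleCat.of R M)
  refine ⟨J, inferInstance, inferInstance,
    (CategoryTheory.Injective.ι (ModuleCat.of R M)).hom, ?_, ?_⟩
  · exact Module.injective_module_of_injective_object R J
      (inj := CategoryTheory.Injective.injective_under (ModuleCat.of R M))
  · exact (ModuleCat.mono_iff_injective _).1 inferInstance

/-- `R ⧸ I` embeds in a free module; the coordinates of the image of `1` annihilate `I`, and only
`I` kills them all. -/
theorem annihilator_annihilator_of_injective_imp_projective
    (h : ∀ (M : Type u) [AddCommGroup M] [Module R M], Module.Injective R M →
      Module.Projective R M) (I : Ideal R) :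
    Submodule.annihilator (Submodule.annihilator I) = I := by
  refine le_antisymm (fun r hr => ?_) fun r hr => ?_
  · obtain ⟨Q, _, _, f, hQ, hf⟩ := exists_injective_linearMap_injective_module (R := R) (R ⧸ I)
    have := h Q hQ
    obtain ⟨φ, hφ⟩ := Module.Projective.exists_injective_finsupp R Q
    rw [← Ideal.Quotient.eq_zero_iff_mem]
    apply (hφ.comp hf)
    simp only [Function.comp_apply, map_zero]
    have key : ∀ a : R, φ (f (Ideal.Quotient.mk I a)) = a • φ (f (Ideal.Quotient.mk I 1)) := by
      intro a
      rw [← map_smul, ← map_smul]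
      congr 2
      rw [← Ideal.Quotient.mk_eq_mk, ← Ideal.Quotient.mk_eq_mk, ← Submodule.Quotient.mk_smul,
        smul_eq_mul, mul_one]
    rw [key]
    ext q
    rw [Finsupp.smul_apply, Finsupp.zero_apply]
    refine Submodule.mem_annihilator.1 hr _ (Submodule.mem_annihilator.2 fun a ha => ?_)
    have h1 := key a
    rw [Ideal.Quotient.eq_zero_iff_mem.2 ha, map_zero, map_zero] at h1
    rw [smul_eq_mul, mul_comm]
    exact (DFunLike.congr_fun h1 q).symm
  · refine Submodule.mem_annihilator.2 fun a ha => ?_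
    rw [smul_eq_mul, mul_comm]
    exact Submodule.mem_annihilator.1 ha r hr

theorem isArtinianRing_of_injective_imp_projective
    (h : ∀ (M : Type u) [AddCommGroup M] [Module R M], Module.Injective R M →
      Module.Projective R M) : IsArtinianRing R := by
  have := isNoetherianRing_of_injective_imp_projective h
  refine monotone_stabilizes_iff_artinian.1 fun I => ?_
  obtain ⟨n, hn⟩ := monotone_stabilizes_iff_noetherian.2 this
    ⟨fun k => Submodule.annihilator (OrderDual.ofDual (I k)),
      fun k l hkl => Submodule.annihilator_mono (I.monotone hkl)⟩
  refine ⟨n, fun m hm => ?_⟩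
  have h1 := congrArg Submodule.annihilator (hn m hm)
  exact (annihilator_annihilator_of_injective_imp_projective h _).symm.trans
    (h1.trans (annihilator_annihilator_of_injective_imp_projective h _))

/-! ### Trace ideals and self-injectivity -/

theorem injective_self_of_iSup_range_eq_top {E : Type u} [AddCommGroup E] [Module R E]
    (hE : Module.Injective R E) (h : (⨆ f : E →ₗ[R] R, LinearMap.range f) = ⊤) :
    Module.Injective R R := by
  refine ⟨fun X Y _ _ _ _ i hi g => ?_⟩
  -- Multiples of `g` by `f e` extend through `E`; sums of such scalars reach `1`.
  suffices H : ∀ r ∈ ⨆ f : E →ₗ[R] R, LinearMap.range f,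
      ∃ k : Y →ₗ[R] R, ∀ x, k (i x) = g x * r by
    obtain ⟨k, hk⟩ := H 1 (h ▸ Submodule.mem_top)
    exact ⟨k, fun x => by rw [hk, mul_one]⟩
  intro r hr
  induction hr using Submodule.iSup_induction' with
  | mem f r hr =>
    obtain ⟨e, rfl⟩ := hr
    obtain ⟨k, hk⟩ := hE.out i hi ((LinearMap.toSpanSingleton R E e) ∘ₗ g)
    exact ⟨f ∘ₗ k, fun x => by simp [hk]⟩
  | zero => exact ⟨0, fun x => by simp⟩
  | add r s _ _ hr hs =>
    obtain ⟨k, hk⟩ := hr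
    obtain ⟨l, hl⟩ := hs
    exact ⟨k + l, fun x => by simp [hk, hl, mul_add]⟩

/-- By the dual basis the trace ideal is idempotent, hence generated by an idempotent `e`; then `1 -
e` kills `E`. -/
theorem iSup_range_eq_top_of_projective [IsNoetherianRing R] {E : Type*} [AddCommGroup E]
    [Module R E] [hE : Module.Projective R E] (hfaith : ∀ r : R, (∀ x : E, r • x = 0) → r = 0) :
    (⨆ f : E →ₗ[R] R, LinearMap.range f) = ⊤ := by
  obtain ⟨s, hs⟩ := hE.out
  set T : Ideal R := ⨆ f : E →ₗ[R] R, LinearMap.range f with hT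
  have hmem : ∀ (f : E →ₗ[R] R) x, f x ∈ T := fun f x =>
    Submodule.mem_iSup_of_mem f (LinearMap.mem_range_self f x)
  have hcoord : ∀ x y : E, s x y ∈ T := fun x y => hmem (Finsupp.lapply y ∘ₗ s) x
  have hsum : ∀ x : E, (s x).sum (fun y a => a • y) = x := fun x => by
    simpa [Finsupp.linearCombination_apply] using hs x
  have hidem : IsIdempotentElem T := by
    refine le_antisymm Ideal.mul_le_left (iSup_le fun f => ?_)
    rintro _ ⟨x, rfl⟩
    rw [← hsum x, Finsupp.sum, map_sum]
    refine Submodule.sum_mem _ fun y _ => ?_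
    rw [map_smul, smul_eq_mul]
    exact Ideal.mul_mem_mul (hcoord x y) (hmem f y)
  obtain ⟨e, he, hTe⟩ := (Ideal.isIdempotentElem_iff_of_fg T (IsNoetherian.noetherian T)).1 hidem
  have h1 : 1 - e = 0 := by
    refine hfaith _ fun x => ?_
    rw [← hsum x, Finsupp.sum, Finset.smul_sum]
    refine Finset.sum_eq_zero fun y _ => ?_
    have hy := hcoord x y
    rw [hTe, Submodule.mem_span_singleton] at hy
    obtain ⟨a, ha⟩ := hy
    rw [← ha, smul_smul, smul_eq_mul, mul_left_comm, sub_mul, one_mul, he.eq, sub_self, mul_zero,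
      zero_smul]
  rw [Ideal.eq_top_iff_one, sub_eq_zero.1 h1, hTe]
  exact Submodule.mem_span_singleton_self e

theorem isQuasiFrobenius_of_injective_imp_projective
    (h : ∀ (M : Type u) [AddCommGroup M] [Module R M], Module.Injective R M →
      Module.Projective R M) : IsQuasiFrobenius R := by
  have := isNoetherianRing_of_injective_imp_projective h
  have hE : Module.Injective R (CharacterModule R) :=
    Module.Flat.iff_characterModule_injective.1 inferInstance
  have := h _ hE
  refine ⟨isArtinianRing_of_injective_imp_projective h,
    injective_self_of_iSup_range_eq_top hE (iSup_range_eq_top_of_projective fun r hr => ?_)⟩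
  rw [← Ideal.mem_bot, CharacterModule.forall_smul_eq_zero_iff]
  exact fun c _ => hr c

/-! ### Strongly `Red`-injective modules over Artinian rings -/

theorem Module.Injective.isStronglyRedInjective {M : Type u} [AddCommGroup M] [Module R M]
    (h : Module.Injective R M) : IsStronglyRedInjective R M :=
  fun _ _ _ K _ f => h.out K.subtype K.injective_subtype f

theorem isReducedModule_of_nilradical_smul {R : Type u} {N : Type v} [CommRing R]
    [IsArtinianRing R] [AddCommGroup N] [Module R N]
    (h : ∀ a ∈ nilradical R, ∀ x : N, a • x = 0) : IsReducedModule R N := by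
  intro r x hx
  -- The powers of `r` stabilise, `r ^ (n + 1) * y = r ^ n`, so `r - r ^ 2 * y` is nilpotent.
  obtain ⟨n, y, hy⟩ := IsArtinian.exists_pow_succ_smul_dvd r (1 : R)
  simp only [Nat.succ_eq_add_one, smul_eq_mul, mul_one] at hy
  have hnil : r - r ^ 2 * y ∈ nilradical R := by
    refine ⟨n + 1, ?_⟩
    have h0 : r ^ n * (1 - r * y) = 0 := by linear_combination -hy
    calc (r - r ^ 2 * y) ^ (n + 1) = (r * (1 - r * y)) ^ (n + 1) := by congr 1; ring
      _ = (r ^ n * (1 - r * y)) * (r * (1 - r * y) ^ n) := by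
          rw [mul_pow]; ring
      _ = 0 := by rw [h0, zero_mul]
  have h1 := h _ hnil x
  rwa [sub_smul, mul_comm, mul_smul, hx, smul_zero, sub_zero] at h1

theorem IsReducedModule.isSemiReducedModule {R : Type u} {N : Type v} [CommRing R]
    [AddCommGroup N] [Module R N] (h : IsReducedModule R N) : IsSemiReducedModule R N :=
  top_le_iff.1 <| le_sSup fun r m hm => Subtype.ext <| h r m <| congrArg Subtype.val hm


theorem IsStronglyRedInjective.exists_extend [IsArtinianRing R] {M : Type u} [AddCommGroup M]
    [Module R M] (hM : IsStronglyRedInjective R M) (n : ℕ) :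
    ∀ (N : Type u) [AddCommGroup N] [Module R N] (K : Submodule R N) (f : K →ₗ[R] M),
      (∀ a ∈ nilradical R ^ n, ∀ x ∈ K, a • x = 0) → ∃ g : N →ₗ[R] M, ∀ x : K, g x = f x := by
  induction n with
  | zero =>
    intro N _ _ K f h
    refine ⟨0, fun x => ?_⟩
    have hx : x = 0 := Subtype.ext <| by simpa using h 1 (by simp) x x.2
    rw [hx, map_zero, LinearMap.zero_apply]
  | succ n ih =>
    intro N _ _ K f h
    let K' : Submodule R N := K ⊓ Submodule.torsionBySet R N (nilradical R)
    have hK' : ∀ x, x ∈ K' ↔ x ∈ K ∧ ∀ a ∈ nilradical R, a • x = 0 := fun x => by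
      simp [K', Submodule.mem_torsionBySet_iff]
    have hred : IsSemiReducedModule R K' :=
      (isReducedModule_of_nilradical_smul fun a ha x =>
        Subtype.ext (((hK' x).1 x.2).2 a ha)).isSemiReducedModule
    obtain ⟨g₁, hg₁⟩ := hM N K' hred (f ∘ₗ Submodule.inclusion inf_le_left)
    -- The error `f'` vanishes on `K'`, so it descends to `K / K'`, which `nilradical R ^ n` kills.
    let f' : K →ₗ[R] M := f - g₁ ∘ₗ K.subtype
    let p : K →ₗ[R] K.map K'.mkQ := K'.mkQ.submoduleMap K
    have hp : Function.Surjective p := K'.mkQ.submoduleMap_surjective K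
    have hker : LinearMap.ker p ≤ LinearMap.ker f' := by
      intro x hx
      have hx' : K'.mkQ (x : N) = 0 := congrArg Subtype.val hx
      rw [Submodule.mkQ_apply, Submodule.Quotient.mk_eq_zero] at hx'
      have := hg₁ ⟨x, hx'⟩
      rw [LinearMap.mem_ker, LinearMap.sub_apply, sub_eq_zero]
      exact this.symm
    obtain ⟨g₂, hg₂⟩ := ih (N ⧸ K') (K.map K'.mkQ)
      ((LinearMap.ker p).liftQ f' hker ∘ₗ (p.quotKerEquivOfSurjective hp).symm) (by
        rintro a ha _ ⟨x, hx, rfl⟩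
        rw [← map_smul, Submodule.mkQ_apply, Submodule.Quotient.mk_eq_zero, hK']
        refine ⟨K.smul_mem a hx, fun b hb => ?_⟩
        rw [smul_smul]
        refine h _ ?_ x hx
        rw [mul_comm, pow_succ]
        exact Ideal.mul_mem_mul ha hb)
    refine ⟨g₁ + g₂ ∘ₗ K'.mkQ, fun x => ?_⟩
    have h2 := hg₂ (p x)
    have h3 : (p.quotKerEquivOfSurjective hp).symm (p x) = Submodule.Quotient.mk x := by
      rw [LinearEquiv.symm_apply_eq, LinearMap.quotKerEquivOfSurjective_apply_mk]
    rw [LinearMap.comp_apply, LinearEquiv.coe_coe, h3, Submodule.liftQ_apply] at h2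
    have h4 : g₂ (K'.mkQ x) = f x - g₁ x := h2
    rw [LinearMap.add_apply, LinearMap.comp_apply, h4, add_sub_cancel]

theorem IsStronglyRedInjective.injective [IsArtinianRing R] {M : Type u} [AddCommGroup M]
    [Module R M] (hM : IsStronglyRedInjective R M) : Module.Injective R M := by
  refine ⟨fun X Y _ _ _ _ i hi f => ?_⟩
  obtain ⟨n, hn⟩ := IsNoetherianRing.isNilpotent_nilradical R
  obtain ⟨g, hg⟩ := hM.exists_extend n Y (LinearMap.range i)
    (f ∘ₗ (LinearEquiv.ofInjective i hi).symm) (fun a ha x _ => by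
      rw [hn] at ha
      rw [(Submodule.mem_bot R).1 ha, zero_smul])
  refine ⟨g, fun x => (hg ⟨i x, LinearMap.mem_range_self i x⟩).trans ?_⟩
  rw [LinearMap.comp_apply]
  congr 1
  rw [LinearEquiv.coe_coe, LinearEquiv.symm_apply_eq]
  rfl

/-! ### Injectives over a quasi-Frobenius ring -/

theorem exists_ne_zero_forall_mul_eq_zero_of_injective [IsNoetherianRing R]
    (hR : Module.Injective R R) {m : Ideal R} (hm : m ≠ ⊤) :
    ∃ c : R, c ≠ 0 ∧ ∀ a ∈ m, a * c = 0 := by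
  classical
  by_contra! h
  obtain ⟨S, hS⟩ := IsNoetherian.noetherian m
  -- If no nonzero element is killed by `m`, multiplication by its generators is injective; a
  -- retraction writes `1` as an element of `m`.
  let θ : R →ₗ[R] (S → R) := LinearMap.pi fun s => LinearMap.mulLeft R (s : R)
  have hθ : Function.Injective θ := by
    refine (injective_iff_map_eq_zero θ).2 fun r hr => ?_
    by_contra hr0
    obtain ⟨a, ha, har⟩ := h r hr0
    refine har ?_
    have hle : m ≤ LinearMap.ker (LinearMap.mulRight R r) := by
      rw [← hS, Submodule.span_le]
      exact fun s hs => congrFun hr ⟨s, hs⟩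
    exact hle ha
  obtain ⟨k, hk⟩ := hR.out θ hθ LinearMap.id
  refine hm ((Ideal.eq_top_iff_one m).2 ?_)
  have h1 : k (θ 1) = 1 := hk 1
  rw [← h1, LinearMap.pi_apply_eq_sum_univ]
  refine Submodule.sum_mem _ fun s _ => ?_
  have hs : θ 1 s = s := mul_one _
  rw [hs, smul_eq_mul]
  exact m.mul_mem_right _ (hS ▸ Submodule.subset_span s.2)

theorem IsSimpleModule.exists_injective_of_injective [IsNoetherianRing R]
    (hR : Module.Injective R R) (S : Type*) [AddCommGroup S] [Module R S] [IsSimpleModule R S] :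
    ∃ f : S →ₗ[R] R, Function.Injective f := by
  have := IsSimpleModule.nontrivial R S
  obtain ⟨x, hx⟩ := exists_ne (0 : S)
  have hsurj := IsSimpleModule.toSpanSingleton_surjective R hx
  have hmax := IsSimpleModule.ker_toSpanSingleton_isMaximal R hx
  obtain ⟨c, hc, hmc⟩ := exists_ne_zero_forall_mul_eq_zero_of_injective hR hmax.ne_top
  have hle : LinearMap.ker (LinearMap.toSpanSingleton R S x) ≤
      LinearMap.ker (LinearMap.toSpanSingleton R R c) := fun a ha => hmc a ha
  let f : S →ₗ[R] R := (LinearMap.ker (LinearMap.toSpanSingleton R S x)).liftQ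
    (LinearMap.toSpanSingleton R R c) hle ∘ₗ
      (LinearMap.quotKerEquivOfSurjective _ hsurj).symm
  refine ⟨f, LinearMap.injective_of_ne_zero fun h0 => hc ?_⟩
  have h1 : f (LinearMap.quotKerEquivOfSurjective _ hsurj (Submodule.Quotient.mk 1)) = 0 := by
    rw [h0, LinearMap.zero_apply]
  rw [LinearMap.comp_apply, LinearEquiv.coe_coe, LinearEquiv.symm_apply_apply,
    Submodule.liftQ_apply, LinearMap.toSpanSingleton_apply, one_smul] at h1
  exact h1

theorem Module.Injective.finsupp_self [IsNoetherianRing R] (hR : Module.Injective R R)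
    (X : Type u) : Module.Injective R (X →₀ R) := by
  classical
  refine Module.Baer.injective fun I g => ?_
  have hb := Module.Baer.of_injective hR
  have hc : ∀ x : X, ∃ c : R, ∀ a : I, g a x = a * c := by
    intro x
    obtain ⟨k, hk⟩ := hb I (Finsupp.lapply x ∘ₗ g)
    refine ⟨k 1, fun a => ?_⟩
    rw [← smul_eq_mul, ← map_smul, smul_eq_mul, mul_one, hk _ a.2]
    rfl
  choose c hc using hc
  obtain ⟨S, hS⟩ := (Module.Finite.fg_top : (⊤ : Submodule R I).FG)
  -- `I` is finitely generated, so `g` involves only finitely many coordinates.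
  let F : Finset X := S.biUnion fun s => (g s).support
  have hF : ∀ a, g a ∈ Finsupp.supported R R (F : Set X) := by
    have hle : (⊤ : Submodule R I) ≤ (Finsupp.supported R R (F : Set X)).comap g := by
      rw [← hS, Submodule.span_le]
      intro s hs
      rw [SetLike.mem_coe, Submodule.mem_comap, Finsupp.mem_supported]
      exact Finset.coe_subset.2 (Finset.subset_biUnion_of_mem (fun s => (g s).support) hs)
    exact fun a => hle Submodule.mem_top
  refine ⟨LinearMap.toSpanSingleton R _ (∑ x ∈ F, Finsupp.single x (c x)), fun a ha => ?_⟩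
  ext x
  rw [LinearMap.toSpanSingleton_apply, Finsupp.smul_apply, Finsupp.finsetSum_apply]
  simp only [Finsupp.single_apply, Finset.sum_ite_eq', smul_eq_mul]
  split_ifs with hx
  · exact (hc x ⟨a, ha⟩).symm
  · rw [mul_zero]
    exact (Finsupp.notMem_support_iff.1
      fun h => hx ((Finsupp.mem_supported R _).1 (hF ⟨a, ha⟩) h)).symm

theorem Module.Injective.projective_of_isQuasiFrobenius (hR : IsQuasiFrobenius R) {M : Type u}
    [AddCommGroup M] [Module R M] (hM : Module.Injective R M) : Module.Projective R M := by
  classical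
  have := hR.1
  let S : Submodule R M := ⨆ m ∈ {m : Submodule R M | IsSimpleModule R m}, m
  have hSs : IsSemisimpleModule R S :=
    isSemisimpleModule_biSup_of_isSemisimpleModule_submodule fun m (hm : IsSimpleModule R m) =>
      inferInstance
  obtain ⟨s, e, -, hs⟩ := IsSemisimpleModule.exists_linearEquiv_dfinsupp R S
  choose t ht using fun m : s =>
    have := hs m
    IsSimpleModule.exists_injective_of_injective hR.2 m.1
  let τ : S →ₗ[R] (s →₀ R) :=
    (finsuppLequivDFinsupp R).symm.toLinearMap ∘ₗ DFinsupp.mapRange.linearMap t ∘ₗ e.toLinearMap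
  have hτ : Function.Injective τ := by
    refine (finsuppLequivDFinsupp R).symm.injective.comp
      (Function.Injective.comp (g := DFinsupp.mapRange.linearMap t) ?_ e.injective)
    exact (DFinsupp.mapRange_injective (fun m => t m) fun m => map_zero (t m)).2 ht
  obtain ⟨ψ, hψ⟩ := (hR.2.finsupp_self s).out S.subtype S.injective_subtype τ
  -- The socle `S` is essential: a nonzero cyclic submodule has finite length and so contains a
  -- simple one, on which `ψ` agrees with the injective `τ`.
  have hψinj : Function.Injective ψ := by
    refine (injective_iff_map_eq_zero ψ).2 fun x hx => ?_
    by_contra hx0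
    have : Nontrivial (Submodule.span R {x}) :=
      ⟨⟨x, Submodule.mem_span_singleton_self x⟩, 0, fun h => hx0 (congrArg Subtype.val h)⟩
    have := isAtomic_of_orderBot_wellFounded_lt
      (IsWellFounded.wf (r := ((· < ·) : Submodule R (Submodule.span R {x}) → _ → Prop)))
    obtain ⟨A, hA⟩ := IsAtomic.exists_atom (Submodule R (Submodule.span R {x}))
    rw [← isSimpleModule_iff_isAtom] at hA
    let B : Submodule R M := A.map (Submodule.span R {x}).subtype
    have hB : IsSimpleModule R B := IsSimpleModule.congr
      (A.equivMapOfInjective _ (Submodule.injective_subtype _)).symm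
    have hBS : B ≤ S := le_iSup₂_of_le B hB le_rfl
    have := IsSimpleModule.nontrivial R B
    obtain ⟨b, hb⟩ := exists_ne (0 : B)
    have hbx : (b : M) ∈ Submodule.span R {x} := Submodule.map_subtype_le _ _ b.2
    obtain ⟨a, ha⟩ := Submodule.mem_span_singleton.1 hbx
    have h0 : τ ⟨b, hBS b.2⟩ = 0 := by
      rw [← hψ, Submodule.subtype_apply, ← ha, map_smul, hx, smul_zero]
    have hb0 := congrArg Subtype.val ((map_eq_zero_iff τ hτ).1 h0)
    exact hb (Subtype.ext hb0)
  obtain ⟨l, hl⟩ := hM.out ψ hψinj LinearMap.id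
  exact Module.Projective.of_split ψ l (LinearMap.ext hl)

theorem theorem3 (R : Type u) [CommRing R] :
    IsQuasiFrobenius R ↔
      ∀ (M : Type u) [AddCommGroup M] [Module R M],
        IsStronglyRedInjective R M → Module.Projective R M := by
  constructor
  · intro hR M _ _ hM
    have := hR.1
    exact hM.injective.projective_of_isQuasiFrobenius hR
  · exact fun h => isQuasiFrobenius_of_injective_imp_projective fun M _ _ hM =>
      h M hM.isStronglyRedInjective
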